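/- Let $K$ be a field, $P=K[x_1,\dots,x_n]$, and let $\mathbb{X}\subseteq\mathbb{A}^n_K$ be a $0$-dimensional subscheme with vanishing ideal $I_{\mathbb{X}}\subset P$, i.e. $R_{\mathbb{X}}=P/I_{\mathbb{X}}$ has Krull dimension $0$. For $f\in P\setminus\{0\}$ let $\mathrm{DF}(f)$ be its homogeneous component of highest degree, and let $\mathrm{DF}(I_{\mathbb{X}})=\langle \mathrm{DF}(f)\mid f\in I_{\mathbb{X}}\setminus\{0\}\rangle$. The following notions are used. - $\mathbb{X}$ is a *strict complete intersection scheme* if $\mathrm{DF}(I_{\mathbb{X}})$ is generated by a regular sequence of homogeneous polynomials in $P$. - A sequence $(f_1,\dots,f_r)$ in $P\setminus K$ is a *strict regular sequence* if $(\mathrm{DF}(f_1),\dots,\mathrm{DF}(f_r))$ is a regular sequence in $P$. - $\mathbb{X}$ is a *locally complete intersection scheme* if for every maximal ideal $\mathfrak{M}\supseteq I_{\mathbb{X}}$ of $P$ the ideal $I_{\mathbb{X}}P_{\mathfrak{M}}$ is generated by a regular sequence of length $n$ in $P_{\mathfrak{M}}$. - A $0$-dimensional local ring $(S,\mathfrak{n})$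 is *Gorenstein* if its socle $\{s\in S\mid \mathfrak{n}s=0\}$ is a $1$-dimensional $S/\mathfrak{n}$-vector space. $\mathbb{X}$ is a *strict Gorenstein scheme* if $P/\mathrm{DF}(I_{\mathbb{X}})$ (the associated graded ring of $R_{\mathbb{X}}$ with respect to the degree filtration) is a $0$-dimensional local Gorenstein ring, and a *locally Gorenstein scheme* if $(R_{\mathbb{X}})_{\mathfrak{m}}$ is Gorenstein for every maximal ideal $\mathfrak{m}$ of $R_{\mathbb{X}}$. Then the following hold. (a) If $\mathbb{X}$ is a strict complete intersection scheme, then there exist non-zero $f_1,\dots,f_n\in I_{\mathbb{X}}$ such that $\mathrm{DF}(I_{\mathbb{X}})=\langle \mathrm{DF}(f_1),\dots,\mathrm{DF}(f_n)\rangle$. (b) Let $f_1,\dots,f_n\in I_{\mathbb{X}}$ be such that $(f_1,\dots,f_n)$ is a strict regular sequence and $\mathrm{DF}(I_{\mathbb{X}})=\langle \mathrm{DF}(f_1),\dots,\mathrm{DF}(f_n)\rangle$. Then $(f_1,\dots,f_n)$ is a regular sequence in $P$ which generates $I_{\mathbb{X}}$. In particular, every strict complete intersection scheme $\mathbb{X}$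 is a locally complete intersection scheme. (c) Every strict complete intersection scheme $\mathbb{X}$ is a strict Gorenstein scheme, and every locally complete intersection scheme $\mathbb{X}$ is a locally Gorenstein scheme. -/

import Mathlib

noncomputable section

/-- The degree form of a polynomial: its homogeneous component of highest degree
(and `0` for the zero polynomial). -/
def degreeForm {K : Type*} [Field K] {n : ℕ} (f : MvPolynomial (Fin n) K) :
    MvPolynomial (Fin n) K :=
  MvPolynomial.homogeneousComponent f.totalDegree f

/-- The degree form ideal of `I`, generated by the degree forms of the non-zero elements
of `I`. -/
def degreeFormIdeal {K : Type*} [Field K] {n : ℕ} (I : Ideal (MvPolynomial (Fin n) K)) :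
    Ideal (MvPolynomial (Fin n) K) :=
  Ideal.span {g | ∃ f ∈ I, f ≠ 0 ∧ degreeForm f = g}

/-- `(f₁, …, fᵣ)` is a strict regular sequence: the `fᵢ` are non-constant polynomials and their
degree forms (which are automatically homogeneous) form a regular sequence. -/
def IsStrictRegularSequence {K : Type*} [Field K] {n r : ℕ}
    (f : Fin r → MvPolynomial (Fin n) K) : Prop :=
  (∀ i, f i ∉ Set.range (MvPolynomial.C : K → MvPolynomial (Fin n) K)) ∧
    RingTheory.Sequence.IsRegular (MvPolynomial (Fin n) K)
      (List.ofFn fun i => degreeForm (f i))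

/-- The scheme defined by `I` is a strict complete intersection: its degree form ideal is generated
by a homogeneous regular sequence (of some length). -/
def IsStrictCompleteIntersection {K : Type*} [Field K] {n : ℕ}
    (I : Ideal (MvPolynomial (Fin n) K)) : Prop :=
  ∃ (r : ℕ) (g : Fin r → MvPolynomial (Fin n) K),
    (∀ i, ∃ d : ℕ, (g i).IsHomogeneous d) ∧
    RingTheory.Sequence.IsRegular (MvPolynomial (Fin n) K) (List.ofFn g) ∧
    degreeFormIdeal I = Ideal.span (Set.range g)

/-- The scheme defined by `I ⊆ P = K[x₁, …, xₙ]` is a complete intersection at the maximal ideal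
`m` of `P/I`: if `M` is the preimage of `m` in `P`, so that `(P/I)_m = P_M / I P_M`, then the
ideal `I P_M` is generated by a regular sequence of length `n` in `P_M`. -/
def IsCompleteIntersectionAt {K : Type*} [Field K] {n : ℕ} (I : Ideal (MvPolynomial (Fin n) K))
    (m : Ideal (MvPolynomial (Fin n) K ⧸ I)) [m.IsMaximal] : Prop :=
  ∃ g : Fin n → Localization.AtPrime (m.comap (Ideal.Quotient.mk I)),
    RingTheory.Sequence.IsRegular (Localization.AtPrime (m.comap (Ideal.Quotient.mk I)))
      (List.ofFn g) ∧
    I.map (algebraMap (MvPolynomial (Fin n) K)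
      (Localization.AtPrime (m.comap (Ideal.Quotient.mk I)))) = Ideal.span (Set.range g)

/-- The scheme defined by `I` is a locally complete intersection scheme. -/
def IsLocallyCompleteIntersection {K : Type*} [Field K] {n : ℕ}
    (I : Ideal (MvPolynomial (Fin n) K)) : Prop :=
  ∀ (m : Ideal (MvPolynomial (Fin n) K ⧸ I)) [m.IsMaximal], IsCompleteIntersectionAt I m

/-- `S` is a `0`-dimensional local Gorenstein ring: it is local with maximal ideal `𝔫`, has Krull
dimension `0`, and its socle, the annihilator `{s | 𝔫 s = 0}` of `𝔫`, is a `1`-dimensional vector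
space over `S/𝔫`. -/
def IsZeroDimGorensteinLocalRing (S : Type*) [CommRing S] : Prop :=
  ∃ _ : IsLocalRing S, ringKrullDim S = 0 ∧
    Module.finrank (S ⧸ IsLocalRing.maximalIdeal S)
      (Submodule.torsionBySet S S (IsLocalRing.maximalIdeal S : Set S)) = 1

/-- The scheme defined by `I` is a strict Gorenstein scheme: the ring `P/DF(I)`, which is the
associated graded ring of `P/I` with respect to the degree filtration, is a (local) Gorenstein
ring. -/
def IsStrictGorenstein {K : Type*} [Field K] {n : ℕ}
    (I : Ideal (MvPolynomial (Fin n) K)) : Prop :=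
  IsZeroDimGorensteinLocalRing (MvPolynomial (Fin n) K ⧸ degreeFormIdeal I)

/-- The scheme defined by `I` is a locally Gorenstein scheme: all localizations of `P/I` at its
maximal ideals are Gorenstein. -/
def IsLocallyGorenstein {K : Type*} [Field K] {n : ℕ}
    (I : Ideal (MvPolynomial (Fin n) K)) : Prop :=
  ∀ (m : Ideal (MvPolynomial (Fin n) K ⧸ I)) [m.IsMaximal],
    IsZeroDimGorensteinLocalRing (Localization.AtPrime m)

end

/-! Write `P = K[x₁, …, xₙ]` and `DF` for degree forms.

**Lifting from degree forms.** Cancelling leading forms, one step of smaller degree at a time, shows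
that elements of `I` whose degree forms generate `DF(I)` generate `I` (`le_of_degreeFormIdeal_le`).
In the same way, if `DF(f)` is a non-zero-divisor modulo `DF(J)`, then `f` is one modulo `J` and
`DF(J + (f)) = DF(J) + (DF(f))`. Induction along the sequence then shows that a sequence with
regular degree forms is regular (`isWeaklyRegular_and_degreeFormIdeal_ofList`).

**The length is `n`.** By induction on `n`, every maximal ideal `M` of `P` is generated by a
regular sequence of length `n` (`MvPolynomial.exists_isWeaklyRegular_ofList_eq`), so `dim P_M = n`.
A regular sequence lowers the dimension of a Noetherian local ring by its length, so one with a
zero-dimensional quotient has length `n` (`length_eq_of_isWeaklyRegular`). The ring `P / DF(I)` is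
local of dimension zero because each `xᵢ` is integral modulo `I`: the degree form of a monic
equation for it is a power of `xᵢ` in `DF(I)`.

**Complete intersections are Gorenstein.** In a Noetherian local ring, two regular sequences of the
same length have quotients with isomorphic socles (`nonempty_socle_equiv_of_isWeaklyRegular`). For
one-element sequences `a` and `b`, the class of `s` corresponds to that of `t` when `b s = a t`; the
general case follows by prime avoidance and permutation of regular sequences. In `P_M` one sequence
may be taken to generate the maximal ideal, and the socle of the residue field is simple. Applied to
`I` this gives the local statement; applied to `DF(I)` it gives the strict one. -/

open MvPolynomial

/-! ### Degree forms and the degree form ideal -/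

section DegreeForm

variable {K : Type*} [Field K] {n : ℕ}

/-- The top-degree part of a product is the product of the top-degree parts, where top degree may be
any upper bound for the total degree. -/
theorem homogeneousComponent_add_mul {p q : MvPolynomial (Fin n) K} {i j : ℕ}
    (hp : p.totalDegree ≤ i) (hq : q.totalDegree ≤ j) :
    homogeneousComponent (i + j) (p * q) =
      homogeneousComponent i p * homogeneousComponent j q := by
  ext d
  rw [coeff_homogeneousComponent, coeff_mul, coeff_mul]
  have key : ∀ x ∈ Finset.HasAntidiagonal.antidiagonal d,
      coeff x.1 (homogeneousComponent i p) * coeff x.2 (homogeneousComponent j q) =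
        if d.degree = i + j then coeff x.1 p * coeff x.2 q else 0 := by
    rintro ⟨u, v⟩ huv
    rw [Finset.HasAntidiagonal.mem_antidiagonal] at huv
    have hdeg : d.degree = u.degree + v.degree := by
      rw [← huv]; simp
    simp only [coeff_homogeneousComponent]
    by_cases hu : i < u.degree
    · have : coeff u p = 0 := coeff_eq_zero_of_totalDegree_lt (hp.trans_lt hu)
      simp [this]
    by_cases hv : j < v.degree
    · have : coeff v q = 0 := coeff_eq_zero_of_totalDegree_lt (hq.trans_lt hv)
      simp [this]
    by_cases h : d.degree = i + j
    · rw [if_pos h, if_pos (by omega), if_pos (by omega)]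
    · rw [if_neg h]
      by_cases hu' : u.degree = i
      · rw [if_neg (show ¬ v.degree = j by omega), mul_zero]
      · rw [if_neg hu', zero_mul]
  rw [Finset.sum_congr rfl key]
  split_ifs <;> simp

theorem totalDegree_lt_of_homogeneousComponent_eq_zero {p : MvPolynomial (Fin n) K} {d : ℕ}
    (hp : p.totalDegree ≤ d) (h : homogeneousComponent d p = 0) :
    p = 0 ∨ p.totalDegree < d := by
  by_contra! hc
  have hd : d = p.totalDegree := le_antisymm hc.2 hp
  obtain ⟨s, hs, hs'⟩ := Finset.exists_mem_eq_sup p.support (support_nonempty.2 hc.1)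
    (fun s => s.sum fun _ e => e)
  have := congrArg (coeff s) h
  rw [coeff_homogeneousComponent, if_pos, coeff_zero] at this
  · exact mem_support_iff.1 hs this
  · rw [hd]; exact hs'.symm

/-- The component of an element of `I` in any degree `d` bounding its total degree lies in `DF(I)`:
it is either its degree form or zero. -/
theorem homogeneousComponent_mem_degreeFormIdeal {I : Ideal (MvPolynomial (Fin n) K)}
    {p : MvPolynomial (Fin n) K} (hp : p ∈ I) {d : ℕ} (hd : p.totalDegree ≤ d) :
    homogeneousComponent d p ∈ degreeFormIdeal I := by
  by_cases h : homogeneousComponent d p = 0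
  · rw [h]; exact zero_mem _
  have hd' : d = p.totalDegree := by
    by_contra hne
    exact h (homogeneousComponent_eq_zero _ _ (lt_of_le_of_ne hd (Ne.symm hne)))
  subst hd'
  exact Ideal.subset_span ⟨p, hp, by rintro rfl; simp at h, rfl⟩

theorem degreeForm_mem_degreeFormIdeal {I : Ideal (MvPolynomial (Fin n) K)}
    {p : MvPolynomial (Fin n) K} (hp : p ∈ I) : degreeForm p ∈ degreeFormIdeal I :=
  homogeneousComponent_mem_degreeFormIdeal hp le_rfl

theorem homogeneousComponent_mul_of_isHomogeneous {a p : MvPolynomial (Fin n) K} {i d : ℕ}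
    (ha : a.IsHomogeneous i) :
    homogeneousComponent d (a * p) = if i ≤ d then a * homogeneousComponent (d - i) p else 0 := by
  conv_lhs => rw [← sum_homogeneousComponent p, Finset.mul_sum, map_sum]
  have key : ∀ j, homogeneousComponent d (a * homogeneousComponent j p) =
      if d = i + j then a * homogeneousComponent j p else 0 := fun j =>
    homogeneousComponent_of_mem (ha.mul (homogeneousComponent_isHomogeneous j p))
  simp only [key]
  split_ifs with h
  · have : ∀ j, (d = i + j) ↔ (d - i = j) := fun j => by omega
    simp only [this, Finset.sum_ite_eq, Finset.mem_range]
    split_ifs with h'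
    · rfl
    · rw [homogeneousComponent_eq_zero _ _ (by omega), mul_zero]
  · exact Finset.sum_eq_zero fun j _ => if_neg (by omega)

/-- Every homogeneous component of an element of `DF(I)` is the degree `d` component of an element
of `I` of degree at most `d`. Together with `homogeneousComponent_mem_degreeFormIdeal` this describes
`DF(I)` degree by degree, and shows that its non-zero homogeneous elements are degree forms. -/
theorem exists_mem_homogeneousComponent_eq {I : Ideal (MvPolynomial (Fin n) K)}
    {g : MvPolynomial (Fin n) K} (hg : g ∈ degreeFormIdeal I) (d : ℕ) :
    ∃ p ∈ I, p.totalDegree ≤ d ∧ homogeneousComponent d p = homogeneousComponent d g := by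
  induction hg using Submodule.span_induction generalizing d with
  | mem g hg =>
    obtain ⟨f, hf, hf0, rfl⟩ := hg
    by_cases h : d = f.totalDegree
    · subst h
      exact ⟨f, hf, le_rfl, (homogeneousComponent_eq_self
        (homogeneousComponent_isHomogeneous _ f)).symm⟩
    · refine ⟨0, zero_mem _, by simp, ?_⟩
      rw [degreeForm, homogeneousComponent_of_mem (homogeneousComponent_isHomogeneous _ f),
        if_neg h, map_zero]
  | zero => exact ⟨0, zero_mem _, by simp, rfl⟩
  | add x y _ _ hx hy =>
    obtain ⟨p, hp, hpd, hpx⟩ := hx d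
    obtain ⟨q, hq, hqd, hqy⟩ := hy d
    exact ⟨p + q, add_mem hp hq, (totalDegree_add _ _).trans (max_le hpd hqd), by
      rw [map_add, map_add, hpx, hqy]⟩
  | smul a x _ hx =>
    choose p hpI hpd hpx using hx
    refine ⟨∑ i ∈ Finset.range (a.totalDegree + 1),
      if i ≤ d then homogeneousComponent i a * p (d - i) else 0, ?_, ?_, ?_⟩
    · refine sum_mem fun i _ => ?_
      split_ifs
      · exact I.mul_mem_left _ (hpI _)
      · exact zero_mem _
    · refine totalDegree_finsetSum_le fun i _ => ?_
      split_ifs with hi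
      · refine (totalDegree_mul _ _).trans ?_
        have h1 := (homogeneousComponent_isHomogeneous i a).totalDegree_le
        have h2 := hpd (d - i)
        omega
      · simp
    · conv_rhs => rw [smul_eq_mul, ← sum_homogeneousComponent a, Finset.sum_mul, map_sum]
      rw [map_sum]
      refine Finset.sum_congr rfl fun i _ => ?_
      have hi := homogeneousComponent_isHomogeneous i a
      rw [homogeneousComponent_mul_of_isHomogeneous hi]
      split_ifs with h
      · rw [homogeneousComponent_mul_of_isHomogeneous hi, if_pos h, hpx]
      · simp

/-- Elements of `I` whose degree forms generate `DF(I)` generate `I`: an element of `I` is reduced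
to smaller degree by subtracting an element of `J` with the same leading component. -/
theorem le_of_degreeFormIdeal_le {I J : Ideal (MvPolynomial (Fin n) K)} (hJI : J ≤ I)
    (h : degreeFormIdeal I ≤ degreeFormIdeal J) : I ≤ J := by
  suffices H : ∀ d : ℕ, ∀ p ∈ I, p = 0 ∨ p.totalDegree < d → p ∈ J from
    fun p hp => H (p.totalDegree + 1) p hp (Or.inr (Nat.lt_succ_self _))
  intro d
  induction d with
  | zero => rintro p - (rfl | hp); exacts [zero_mem _, absurd hp (Nat.not_lt_zero _)]
  | succ d ih =>
    rintro p hp (rfl | hpd)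
    · exact zero_mem _
    have hpd := Nat.lt_succ_iff.1 hpd
    obtain ⟨q, hq, hqd, hqp⟩ := exists_mem_homogeneousComponent_eq
      (h (homogeneousComponent_mem_degreeFormIdeal hp hpd)) d
    rw [homogeneousComponent_eq_self (homogeneousComponent_isHomogeneous _ p)] at hqp
    have := ih (p - q) (sub_mem hp (hJI hq)) (totalDegree_lt_of_homogeneousComponent_eq_zero
      ((totalDegree_sub _ _).trans (max_le hpd hqd)) (by rw [map_sub, hqp, sub_self]))
    simpa using add_mem this hq

/-- If `DF(f)` is a non-zero-divisor modulo `DF(J)`, then `f` is a non-zero-divisor modulo `J`. -/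
theorem mem_of_mul_mem_of_degreeForm {J : Ideal (MvPolynomial (Fin n) K)}
    {f : MvPolynomial (Fin n) K}
    (hf : ∀ a, degreeForm f * a ∈ degreeFormIdeal J → a ∈ degreeFormIdeal J)
    {a : MvPolynomial (Fin n) K} (ha : f * a ∈ J) : a ∈ J := by
  suffices H : ∀ d : ℕ, ∀ a, f * a ∈ J → a = 0 ∨ a.totalDegree < d → a ∈ J from
    H (a.totalDegree + 1) a ha (Or.inr (Nat.lt_succ_self _))
  clear a ha
  intro d
  induction d with
  | zero => rintro p - (rfl | hp); exacts [zero_mem _, absurd hp (Nat.not_lt_zero _)]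
  | succ d ih =>
    rintro a ha (rfl | had)
    · exact zero_mem _
    have had := Nat.lt_succ_iff.1 had
    have h1 := homogeneousComponent_mem_degreeFormIdeal ha
      ((totalDegree_mul _ _).trans (Nat.add_le_add_left had _))
    rw [homogeneousComponent_add_mul le_rfl had] at h1
    obtain ⟨q, hq, hqd, hqp⟩ := exists_mem_homogeneousComponent_eq (hf _ h1) d
    rw [homogeneousComponent_eq_self (homogeneousComponent_isHomogeneous _ a)] at hqp
    have := ih (a - q) (by rw [mul_sub]; exact sub_mem ha (J.mul_mem_left _ hq))
      (totalDegree_lt_of_homogeneousComponent_eq_zero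
      ((totalDegree_sub _ _).trans (max_le had hqd)) (by rw [map_sub, hqp, sub_self]))
    simpa using add_mem this hq

theorem degreeFormIdeal_mono {I J : Ideal (MvPolynomial (Fin n) K)} (h : I ≤ J) :
    degreeFormIdeal I ≤ degreeFormIdeal J :=
  Ideal.span_mono fun _ ⟨f, hf, hf'⟩ => ⟨f, h hf, hf'⟩

/-- If `DF(f)` is a non-zero-divisor modulo `DF(J)`, no new degree forms arise from cancellation
in `b + f * a` with `b ∈ J`: whenever the leading components cancel, that of `a` lies in `DF(J)`, and
`a` can be replaced by a polynomial of smaller degree. -/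
theorem degreeFormIdeal_sup_span_singleton {J : Ideal (MvPolynomial (Fin n) K)}
    {f : MvPolynomial (Fin n) K}
    (hf : ∀ a, degreeForm f * a ∈ degreeFormIdeal J → a ∈ degreeFormIdeal J) :
    degreeFormIdeal (J ⊔ Ideal.span {f}) = degreeFormIdeal J ⊔ Ideal.span {degreeForm f} := by
  refine le_antisymm ?_ (sup_le (degreeFormIdeal_mono le_sup_left) ?_)
  swap
  · rw [Ideal.span_singleton_le_iff_mem]
    exact degreeForm_mem_degreeFormIdeal (le_sup_right (a := J) (Ideal.mem_span_singleton_self f))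
  suffices H : ∀ k : ℕ, ∀ a, (a = 0 ∨ a.totalDegree < k) → ∀ b ∈ J,
      degreeForm (b + f * a) ∈ degreeFormIdeal J ⊔ Ideal.span {degreeForm f} by
    refine Ideal.span_le.2 ?_
    rintro _ ⟨h, hh, -, rfl⟩
    obtain ⟨b, hb, c, hc, rfl⟩ := Submodule.mem_sup.1 hh
    obtain ⟨a, rfl⟩ := Ideal.mem_span_singleton.1 hc
    exact H (a.totalDegree + 1) a (Or.inr (Nat.lt_succ_self _)) b hb
  intro k
  induction k with
  | zero =>
    rintro a (rfl | ha) b hb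
    · rw [mul_zero, add_zero]
      exact le_sup_left (a := degreeFormIdeal J) (degreeForm_mem_degreeFormIdeal hb)
    · exact absurd ha (Nat.not_lt_zero _)
  | succ k ih =>
    rintro a (rfl | ha) b hb
    · exact ih 0 (Or.inl rfl) b hb
    have ha := Nat.lt_succ_iff.1 ha
    have hfa : (f * a).totalDegree ≤ f.totalDegree + k :=
      (totalDegree_mul _ _).trans (Nat.add_le_add_left ha _)
    obtain ⟨d, hd⟩ : ∃ d, d = (b + f * a).totalDegree := ⟨_, rfl⟩
    have hb' : b.totalDegree ≤ max d (f.totalDegree + k) := by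
      have := totalDegree_sub (b + f * a) (f * a)
      rw [add_sub_cancel_right, ← hd] at this
      exact this.trans (max_le_max le_rfl hfa)
    rcases le_or_gt (f.totalDegree + k) d with hle | hlt
    · rw [max_eq_left hle] at hb'
      rw [show degreeForm (b + f * a) = homogeneousComponent d (b + f * a) by rw [hd]; rfl, map_add]
      refine Submodule.add_mem_sup (homogeneousComponent_mem_degreeFormIdeal hb hb') ?_
      obtain ⟨j, rfl⟩ := Nat.exists_eq_add_of_le ((Nat.le_add_right _ _).trans hle)
      rw [homogeneousComponent_add_mul le_rfl (by omega)]
      exact Ideal.mul_mem_right _ _ (Ideal.mem_span_singleton_self _)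
    · rw [max_eq_right hlt.le] at hb'
      -- the leading forms of `b` and `f * a` cancel, so the leading form of `a` can be removed
      have h0 : homogeneousComponent (f.totalDegree + k) (b + f * a) = 0 :=
        homogeneousComponent_eq_zero _ _ (hd ▸ hlt)
      rw [map_add, homogeneousComponent_add_mul le_rfl ha] at h0
      have h1 : degreeForm f * homogeneousComponent k a ∈ degreeFormIdeal J := by
        rw [degreeForm, eq_neg_of_add_eq_zero_right h0]
        exact neg_mem (homogeneousComponent_mem_degreeFormIdeal hb hb')
      obtain ⟨q, hq, hqd, hqp⟩ := exists_mem_homogeneousComponent_eq (hf _ h1) k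
      rw [homogeneousComponent_eq_self (homogeneousComponent_isHomogeneous _ a)] at hqp
      have := ih (a - q) (totalDegree_lt_of_homogeneousComponent_eq_zero
        ((totalDegree_sub _ _).trans (max_le ha hqd)) (by rw [map_sub, hqp, sub_self]))
        (b + f * q) (add_mem hb (J.mul_mem_left _ hq))
      rwa [show b + f * q + f * (a - q) = b + f * a by ring] at this

theorem degreeFormIdeal_bot : degreeFormIdeal (⊥ : Ideal (MvPolynomial (Fin n) K)) = ⊥ := by
  refine Ideal.span_eq_bot.2 ?_
  rintro _ ⟨f, hf, hf0, -⟩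
  exact absurd hf hf0

open RingTheory.Sequence in
theorem isWeaklyRegular_and_degreeFormIdeal_ofList (l : List (MvPolynomial (Fin n) K))
    (h : IsWeaklyRegular (MvPolynomial (Fin n) K) (l.map degreeForm)) :
    IsWeaklyRegular (MvPolynomial (Fin n) K) l ∧
      degreeFormIdeal (Ideal.ofList l) = Ideal.ofList (l.map degreeForm) := by
  induction l using List.reverseRecOn with
  | nil => simp [degreeFormIdeal_bot]
  | append_singleton l f ih =>
    rw [List.map_append, List.map_singleton, isWeaklyRegular_append_iff,
      isWeaklyRegular_singleton_iff] at h
    obtain ⟨h1, h2⟩ := ih h.1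
    have h3 := h.2
    rw [← h2, smul_eq_mul, Ideal.mul_top, isSMulRegular_quotient_iff_mem_of_smul_mem] at h3
    refine ⟨?_, ?_⟩
    · rw [isWeaklyRegular_append_iff, isWeaklyRegular_singleton_iff, smul_eq_mul, Ideal.mul_top,
        isSMulRegular_quotient_iff_mem_of_smul_mem]
      exact ⟨h1, fun a => mem_of_mul_mem_of_degreeForm h3⟩
    · rw [List.map_append, List.map_singleton, Ideal.ofList_append, Ideal.ofList_append,
        Ideal.ofList_singleton, Ideal.ofList_singleton, degreeFormIdeal_sup_span_singleton h3, h2]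

theorem exists_degreeForm_eq {I : Ideal (MvPolynomial (Fin n) K)} {g : MvPolynomial (Fin n) K}
    {d : ℕ} (hgd : g.IsHomogeneous d) (hg0 : g ≠ 0) (hg : g ∈ degreeFormIdeal I) :
    ∃ f ∈ I, f ≠ 0 ∧ degreeForm f = g := by
  obtain ⟨p, hp, hpd, hpg⟩ := exists_mem_homogeneousComponent_eq hg d
  rw [homogeneousComponent_eq_self hgd] at hpg
  have hd : p.totalDegree = d := by
    by_contra hne
    exact hg0 (hpg ▸ homogeneousComponent_eq_zero _ _ (lt_of_le_of_ne hpd hne))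
  refine ⟨p, hp, ?_, by rw [degreeForm, hd, hpg]⟩
  rintro rfl
  exact hg0 (by rw [← hpg, map_zero])

theorem degreeFormIdeal_ne_top {I : Ideal (MvPolynomial (Fin n) K)} (hI : I ≠ ⊤) :
    degreeFormIdeal I ≠ ⊤ := by
  intro h
  obtain ⟨p, hp, hpd, hpg⟩ := exists_mem_homogeneousComponent_eq
    (I := I) (g := 1) (h ▸ Submodule.mem_top) 0
  rw [homogeneousComponent_zero, homogeneousComponent_zero, coeff_zero_one, C_1] at hpg
  rw [totalDegree_eq_zero_iff_eq_C.1 (Nat.le_zero.1 hpd), hpg] at hp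
  exact hI ((Ideal.eq_top_iff_one I).2 hp)

theorem totalDegree_aeval_X_le (p : Polynomial K) (i : Fin n) :
    (Polynomial.aeval (X i : MvPolynomial (Fin n) K) p).totalDegree ≤ p.natDegree := by
  rw [Polynomial.aeval_eq_sum_range]
  refine totalDegree_finsetSum_le fun j hj => (totalDegree_smul_le _ _).trans ?_
  rw [totalDegree_X_pow]
  exact Nat.lt_succ_iff.1 (Finset.mem_range.1 hj)

theorem homogeneousComponent_aeval_X {p : Polynomial K} (hp : p.Monic) (i : Fin n) :
    homogeneousComponent p.natDegree (Polynomial.aeval (X i : MvPolynomial (Fin n) K) p) =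
      X i ^ p.natDegree := by
  have key : ∀ j, homogeneousComponent p.natDegree (X i ^ j : MvPolynomial (Fin n) K) =
      if p.natDegree = j then X i ^ j else 0 := fun j =>
    homogeneousComponent_of_mem (isHomogeneous_X_pow i j)
  rw [Polynomial.aeval_eq_sum_range, map_sum]
  simp only [map_smul, key, smul_ite, smul_zero]
  rw [Finset.sum_ite_eq, if_pos (Finset.self_mem_range_succ _), hp.coeff_natDegree, one_smul]

theorem exists_X_pow_mem_degreeFormIdeal {I : Ideal (MvPolynomial (Fin n) K)}
    [Ring.KrullDimLE 0 (MvPolynomial (Fin n) K ⧸ I)] (i : Fin n) :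
    ∃ d, X i ^ d ∈ degreeFormIdeal I := by
  have hfin : Module.Finite K (MvPolynomial (Fin n) K ⧸ I) :=
    (Module.finite_iff_krullDimLE_zero K _).2 inferInstance
  obtain ⟨p, hp, hpe⟩ := Algebra.IsIntegral.isIntegral (R := K)
    (Ideal.Quotient.mkₐ K I (X i : MvPolynomial (Fin n) K))
  refine ⟨p.natDegree, ?_⟩
  rw [← homogeneousComponent_aeval_X hp]
  refine homogeneousComponent_mem_degreeFormIdeal ?_ (totalDegree_aeval_X_le p i)
  rw [← Ideal.Quotient.eq_zero_iff_mem, ← Ideal.Quotient.mkₐ_eq_mk K, ← Polynomial.aeval_algHom_apply]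
  exact hpe

/-- In dimension zero each indeterminate is integral modulo `I`, so a power of it lies in `DF(I)`;
hence the ideal of all indeterminates, written as the kernel of `constantCoeff`, is the only prime
ideal containing `DF(I)`. -/
theorem eq_of_degreeFormIdeal_le_of_isPrime {I : Ideal (MvPolynomial (Fin n) K)}
    [Ring.KrullDimLE 0 (MvPolynomial (Fin n) K ⧸ I)] {Q : Ideal (MvPolynomial (Fin n) K)}
    [hQ : Q.IsPrime] (h : degreeFormIdeal I ≤ Q) :
    Q = RingHom.ker (constantCoeff : MvPolynomial (Fin n) K →+* K) := by
  have hmax : (RingHom.ker (constantCoeff : MvPolynomial (Fin n) K →+* K)).IsMaximal :=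
    RingHom.ker_isMaximal_of_surjective _ fun c => ⟨C c, constantCoeff_C _ c⟩
  refine (hmax.eq_of_le hQ.ne_top ?_).symm
  have hX : ∀ i : Fin n, X i ∈ Q := fun i =>
    (exists_X_pow_mem_degreeFormIdeal (I := I) i).elim fun d hd => hQ.mem_of_pow_mem d (h hd)
  intro p hp
  have hspan : Ideal.span (X '' (Set.univ : Set (Fin n))) ≤ Q := by
    rw [Ideal.span_le]
    rintro _ ⟨i, -, rfl⟩
    exact hX i
  refine hspan (mem_ideal_span_X_image.2 fun m hm => ?_)
  by_contra! hc
  obtain rfl : m = 0 := Finsupp.ext fun i => hc i (Set.mem_univ i)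
  exact mem_support_iff.1 hm hp

theorem krullDimLE_zero_quotient_degreeFormIdeal {I : Ideal (MvPolynomial (Fin n) K)}
    [Ring.KrullDimLE 0 (MvPolynomial (Fin n) K ⧸ I)] :
    Ring.KrullDimLE 0 (MvPolynomial (Fin n) K ⧸ degreeFormIdeal I) := by
  refine .mk₀ fun Q hQ => ?_
  have hle : degreeFormIdeal I ≤ Q.comap (Ideal.Quotient.mk (degreeFormIdeal I)) := fun x hx => by
    rw [Ideal.mem_comap, Ideal.Quotient.eq_zero_iff_mem.2 hx]
    exact zero_mem _
  have hmax : (Q.comap (Ideal.Quotient.mk (degreeFormIdeal I))).IsMaximal := by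
    rw [eq_of_degreeFormIdeal_le_of_isPrime hle]
    exact RingHom.ker_isMaximal_of_surjective _ fun c => ⟨C c, constantCoeff_C _ c⟩
  have := Ideal.map_eq_top_or_isMaximal_of_surjective
    (Ideal.Quotient.mk (degreeFormIdeal I)) Ideal.Quotient.mk_surjective hmax
  rw [Ideal.map_comap_of_surjective _ Ideal.Quotient.mk_surjective] at this
  exact this.resolve_left hQ.ne_top

theorem isLocalRing_quotient_degreeFormIdeal {I : Ideal (MvPolynomial (Fin n) K)}
    [Ring.KrullDimLE 0 (MvPolynomial (Fin n) K ⧸ I)] (hI : I ≠ ⊤) :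
    IsLocalRing (MvPolynomial (Fin n) K ⧸ degreeFormIdeal I) := by
  have : Nontrivial (MvPolynomial (Fin n) K ⧸ degreeFormIdeal I) :=
    Ideal.Quotient.nontrivial_iff.2 (degreeFormIdeal_ne_top hI)
  obtain ⟨m, hm⟩ := Ideal.exists_maximal (MvPolynomial (Fin n) K ⧸ degreeFormIdeal I)
  refine .of_unique_max_ideal ⟨m, hm, fun m' hm' => ?_⟩
  have key : ∀ Q : Ideal (MvPolynomial (Fin n) K ⧸ degreeFormIdeal I), Q.IsMaximal →
      Q.comap (Ideal.Quotient.mk _) = RingHom.ker (constantCoeff (R := K) (σ := Fin n)) := by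
    intro Q hQ
    refine eq_of_degreeFormIdeal_le_of_isPrime (I := I) fun x hx => ?_
    rw [Ideal.mem_comap, Ideal.Quotient.eq_zero_iff_mem.2 hx]
    exact zero_mem _
  exact Ideal.comap_injective_of_surjective _ Ideal.Quotient.mk_surjective
    ((key m' hm').trans (key m hm).symm)

end DegreeForm

/-! ### Socles of quotients by regular sequences -/

section Socle

open IsLocalRing RingTheory.Sequence Submodule
open scoped Pointwise

variable {R M N : Type*} [CommRing R] [AddCommGroup M] [Module R M] [AddCommGroup N] [Module R N]

/-- The socle of `M` with respect to an ideal `J`, usually the maximal ideal of a local ring: the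
elements of `M` killed by `J`. -/
abbrev socle (J : Ideal R) (M : Type*) [AddCommGroup M] [Module R M] : Submodule R M :=
  torsionBySet R M (J : Set R)

theorem mem_socle_iff {J : Ideal R} {m : M} : m ∈ socle J M ↔ ∀ x ∈ J, x • m = 0 := by
  simp [socle, mem_torsionBySet_iff]

/-- Isomorphic modules have isomorphic socles. -/
def socleCongr (J : Ideal R) (e : M ≃ₗ[R] N) : socle J M ≃ₗ[R] socle J N :=
  e.ofSubmodules _ _ <| by
    ext y
    rw [Submodule.mem_map_equiv, mem_socle_iff, mem_socle_iff]
    simp [← map_smul]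

theorem mem_socle_quotSMulTop_iff {J : Ideal R} {a : R} {m : M} :
    (Submodule.Quotient.mk m : QuotSMulTop a M) ∈ socle J (QuotSMulTop a M) ↔
      ∀ x ∈ J, ∃ u, a • u = x • m := by
  rw [mem_socle_iff]
  refine forall₂_congr fun x _ => ?_
  rw [← Submodule.Quotient.mk_smul, Submodule.Quotient.mk_eq_zero,
    Submodule.mem_smul_pointwise_iff_exists]
  simp

/-- The pairs `(s, t)` with `b • s = a • t` such that `s` represents a socle element of `M / aM`
and `t` one of `M / bM`. Its two projections identify the socles of `M / aM` and `M / bM`. -/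
def socleCorrespondence (J : Ideal R) (a b : R) (M : Type*) [AddCommGroup M] [Module R M] :
    Submodule R (M × M) where
  carrier := {p | b • p.1 = a • p.2 ∧ (Submodule.Quotient.mk p.1 : QuotSMulTop a M) ∈ socle J _ ∧
    (Submodule.Quotient.mk p.2 : QuotSMulTop b M) ∈ socle J _}
  add_mem' := fun {p q} hp hq => ⟨by simp [smul_add, hp.1, hq.1], add_mem hp.2.1 hq.2.1,
    add_mem hp.2.2 hq.2.2⟩
  zero_mem' := ⟨by simp, zero_mem _, zero_mem _⟩
  smul_mem' := fun c p hp => ⟨by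
    simp only [Prod.smul_fst, Prod.smul_snd]; rw [smul_comm b c, hp.1, smul_comm],
    Submodule.smul_mem _ c hp.2.1, Submodule.smul_mem _ c hp.2.2⟩

theorem socle_eq_of_smul_eq {J : Ideal R} {a b : R} (ha : IsSMulRegular M a) {s t : M}
    (hst : b • s = a • t) (hs : (Submodule.Quotient.mk s : QuotSMulTop a M) ∈ socle J _) :
    (Submodule.Quotient.mk t : QuotSMulTop b M) ∈ socle J _ := by
  rw [mem_socle_quotSMulTop_iff] at hs ⊢
  intro x hx
  obtain ⟨u, hu⟩ := hs x hx
  refine ⟨u, ha ?_⟩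
  change a • b • u = a • x • t
  rw [smul_comm a b, hu, smul_comm b x, hst, smul_comm]

/-- If `a, b ∈ J` are `M`-regular, then `M / aM` and `M / bM` have isomorphic socles. Both
projections of `socleCorrespondence` are surjective, with common kernel `{(a • u, b • u)}`. -/
theorem nonempty_socle_quotSMulTop_equiv {J : Ideal R} {a b : R} (haJ : a ∈ J) (hbJ : b ∈ J)
    (ha : IsSMulRegular M a) (hb : IsSMulRegular M b) :
    Nonempty (socle J (QuotSMulTop a M) ≃ₗ[R] socle J (QuotSMulTop b M)) := by
  let W := socleCorrespondence J a b M
  let f : W →ₗ[R] socle J (QuotSMulTop a M) :=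
    ((mkQ _).comp ((LinearMap.fst R M M).comp W.subtype)).codRestrict _ fun w => w.2.2.1
  let g : W →ₗ[R] socle J (QuotSMulTop b M) :=
    ((mkQ _).comp ((LinearMap.snd R M M).comp W.subtype)).codRestrict _ fun w => w.2.2.2
  have hf : Function.Surjective f := by
    rintro ⟨s, hs⟩
    obtain ⟨s, rfl⟩ := Submodule.Quotient.mk_surjective _ s
    obtain ⟨t, ht⟩ := mem_socle_quotSMulTop_iff.1 hs b hbJ
    exact ⟨⟨(s, t), ht.symm, hs, socle_eq_of_smul_eq ha ht.symm hs⟩, rfl⟩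
  have hg : Function.Surjective g := by
    rintro ⟨t, ht⟩
    obtain ⟨t, rfl⟩ := Submodule.Quotient.mk_surjective _ t
    obtain ⟨s, hs⟩ := mem_socle_quotSMulTop_iff.1 ht a haJ
    exact ⟨⟨(s, t), hs, socle_eq_of_smul_eq hb hs.symm ht, ht⟩, rfl⟩
  have hker : LinearMap.ker f = LinearMap.ker g := by
    ext ⟨⟨s, t⟩, hst, hs, ht⟩
    have h1 : f ⟨⟨s, t⟩, hst, hs, ht⟩ = 0 ↔ ∃ u, a • u = s := by
      rw [← Subtype.coe_inj]
      change (Submodule.Quotient.mk s : QuotSMulTop a M) = 0 ↔ _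
      rw [Submodule.Quotient.mk_eq_zero, Submodule.mem_smul_pointwise_iff_exists]
      simp
    have h2 : g ⟨⟨s, t⟩, hst, hs, ht⟩ = 0 ↔ ∃ u, b • u = t := by
      rw [← Subtype.coe_inj]
      change (Submodule.Quotient.mk t : QuotSMulTop b M) = 0 ↔ _
      rw [Submodule.Quotient.mk_eq_zero, Submodule.mem_smul_pointwise_iff_exists]
      simp
    rw [LinearMap.mem_ker, LinearMap.mem_ker, h1, h2]
    change b • s = a • t at hst
    refine exists_congr fun u => ⟨fun h => ha ?_, fun h => hb ?_⟩
    · change a • b • u = a • t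
      rw [← hst, ← h, smul_comm]
    · change b • a • u = b • s
      rw [hst, ← h, smul_comm]
  exact ⟨(f.quotKerEquivOfSurjective hf).symm ≪≫ₗ quotEquivOfEq _ _ hker ≪≫ₗ
    g.quotKerEquivOfSurjective hg⟩

/-- Prime avoidance: an ideal containing a regular element on each of two finite modules contains
an element that is regular on both. -/
theorem exists_mem_isSMulRegular_both [IsNoetherianRing R] [Module.Finite R M] [Module.Finite R N]
    {J : Ideal R} {a b : R} (haJ : a ∈ J) (hbJ : b ∈ J)
    (ha : IsSMulRegular M a) (hb : IsSMulRegular N b) :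
    ∃ c ∈ J, IsSMulRegular M c ∧ IsSMulRegular N c := by
  by_contra! hc
  have hM := biUnion_associatedPrimes_eq_compl_regular R M
  have hN := biUnion_associatedPrimes_eq_compl_regular R N
  obtain ⟨P, hP, hJP⟩ := (J.subset_union_prime_finite
    ((associatedPrimes.finite R M).union (associatedPrimes.finite R N)) (f := id) 0 0
    fun P hP _ _ => hP.elim (fun h => h.isPrime) (fun h => h.isPrime)).1 <| by
      intro c hcJ
      rw [Set.biUnion_union]
      simp only [id]
      rw [hM, hN]
      by_cases h : IsSMulRegular M c
      · exact Or.inr (hc c hcJ h)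
      · exact Or.inl h
  rcases hP with hP | hP
  · exact (hM ▸ Set.mem_biUnion hP (hJP haJ) : a ∈ {r : R | IsSMulRegular M r}ᶜ) ha
  · exact (hN ▸ Set.mem_biUnion hP (hJP hbJ) : b ∈ {r : R | IsSMulRegular N r}ᶜ) hb

/-- In a regular sequence `l, a` the last element may be exchanged for any `c` that is regular
modulo `l`, without changing the socle of the quotient; `c` may then be moved to the front. -/
theorem nonempty_socle_quotient_equiv [IsLocalRing R] [IsNoetherianRing R] [Module.Finite R M]
    (l : List R) {a c : R} (hl : ∀ r ∈ a :: l, r ∈ maximalIdeal R) (hc : c ∈ maximalIdeal R)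
    (hal : IsWeaklyRegular M (l ++ [a]))
    (hcl : IsSMulRegular (M ⧸ (Ideal.ofList l • ⊤ : Submodule R M)) c) :
    IsWeaklyRegular (QuotSMulTop c M) l ∧
    Nonempty (socle (maximalIdeal R) (M ⧸ (Ideal.ofList (l ++ [a]) • ⊤ : Submodule R M)) ≃ₗ[R]
      socle (maximalIdeal R)
        (QuotSMulTop c M ⧸ (Ideal.ofList l • ⊤ : Submodule R (QuotSMulTop c M)))) := by
  rw [isWeaklyRegular_append_iff, isWeaklyRegular_singleton_iff] at hal
  have hperm : IsWeaklyRegular M (c :: l) := by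
    refine isWeaklyRegular_of_perm_of_subset_maximalIdeal
      (rs := l ++ [c]) ?_ (List.perm_append_singleton c l) ?_
    · rw [isWeaklyRegular_append_iff, isWeaklyRegular_singleton_iff]
      exact ⟨hal.1, hcl⟩
    · intro r hr
      rcases List.mem_append.1 hr with h | h
      · exact hl r (List.mem_cons_of_mem _ h)
      · rw [List.mem_singleton.1 h]; exact hc
  rw [isWeaklyRegular_cons_iff] at hperm
  refine ⟨hperm.2, ?_⟩
  obtain ⟨e⟩ := nonempty_socle_quotSMulTop_equiv (hl a List.mem_cons_self) hc hal.2 hcl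
  have h : (Ideal.ofList (l ++ [a]) • ⊤ : Submodule R M) = Ideal.ofList (a :: l) • ⊤ := by
    rw [Ideal.ofList_append, Ideal.ofList_singleton, Ideal.ofList_cons, sup_comm]
  exact ⟨socleCongr _ (quotEquivOfEq _ _ h ≪≫ₗ quotOfListConsSMulTopEquivQuotSMulTopOuter M a l)
    ≪≫ₗ e ≪≫ₗ socleCongr _ ((quotOfListConsSMulTopEquivQuotSMulTopOuter M c l).symm ≪≫ₗ
      quotOfListConsSMulTopEquivQuotSMulTopInner M c l)⟩

/-- Over a Noetherian local ring, the quotients of a finite module by two regular sequences of the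
same length have isomorphic socles (both are `Extⁿ` of the residue field with values in `M`). The
proof exchanges both last elements for a common one and inducts. -/
theorem nonempty_socle_equiv_of_isWeaklyRegular [IsLocalRing R] [IsNoetherianRing R]
    [Module.Finite R M] {l₁ l₂ : List R} (hlen : l₁.length = l₂.length)
    (hl₁ : ∀ r ∈ l₁, r ∈ maximalIdeal R) (hl₂ : ∀ r ∈ l₂, r ∈ maximalIdeal R)
    (h₁ : IsWeaklyRegular M l₁) (h₂ : IsWeaklyRegular M l₂) :
    Nonempty (socle (maximalIdeal R) (M ⧸ (Ideal.ofList l₁ • ⊤ : Submodule R M)) ≃ₗ[R]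
      socle (maximalIdeal R) (M ⧸ (Ideal.ofList l₂ • ⊤ : Submodule R M))) := by
  obtain ⟨k, hk⟩ : ∃ k, k = l₁.length := ⟨_, rfl⟩
  induction k generalizing M l₁ l₂ with
  | zero =>
    obtain rfl := List.length_eq_zero_iff.1 hk.symm
    obtain rfl := List.length_eq_zero_iff.1 hlen.symm
    exact ⟨.refl _ _⟩
  | succ k ih =>
    obtain rfl | ⟨l₁, a, rfl⟩ := l₁.eq_nil_or_concat'
    · simp at hk
    obtain rfl | ⟨l₂, b, rfl⟩ := l₂.eq_nil_or_concat'
    · simp at hlen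
    simp only [List.mem_append, List.mem_singleton, List.length_append,
      List.length_singleton] at hl₁ hl₂ hlen hk
    have ha := hl₁ a (Or.inr rfl)
    have hb := hl₂ b (Or.inr rfl)
    have h₁' := h₁
    have h₂' := h₂
    rw [isWeaklyRegular_append_iff, isWeaklyRegular_singleton_iff] at h₁' h₂'
    obtain ⟨c, hc, hc₁, hc₂⟩ := exists_mem_isSMulRegular_both ha hb h₁'.2 h₂'.2
    have hl₁' : ∀ r ∈ a :: l₁, r ∈ maximalIdeal R := fun r hr =>
      hl₁ r ((List.mem_cons.1 hr).symm)
    have hl₂' : ∀ r ∈ b :: l₂, r ∈ maximalIdeal R := fun r hr =>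
      hl₂ r ((List.mem_cons.1 hr).symm)
    obtain ⟨w₁, ⟨e₁⟩⟩ := nonempty_socle_quotient_equiv l₁ hl₁' hc h₁ hc₁
    obtain ⟨w₂, ⟨e₂⟩⟩ := nonempty_socle_quotient_equiv l₂ hl₂' hc h₂ hc₂
    obtain ⟨e⟩ := ih (by omega) (fun r hr => hl₁ r (Or.inl hr)) (fun r hr => hl₂ r (Or.inl hr))
      w₁ w₂ (by omega)
    exact ⟨e₁ ≪≫ₗ e ≪≫ₗ e₂.symm⟩

theorem isZeroDimGorensteinLocalRing_of_exists {S : Type*} [CommRing S] [IsLocalRing S]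
    (hdim : ringKrullDim S = 0) {s : S} (hs0 : s ≠ 0)
    (hs : ∀ x ∈ maximalIdeal S, x * s = 0)
    (hgen : ∀ t, (∀ x ∈ maximalIdeal S, x * t = 0) → ∃ c, c * s = t) :
    IsZeroDimGorensteinLocalRing S := by
  refine ⟨inferInstance, hdim, ?_⟩
  let v : torsionBySet S S (maximalIdeal S : Set S) := ⟨s, (mem_torsionBySet_iff _ _).2 fun x =>
    hs x x.2⟩
  let _ : Field (S ⧸ maximalIdeal S) := Ideal.Quotient.field _
  refine (finrank_eq_one_iff_of_nonzero' v fun h => hs0 (congrArg Subtype.val h)).2 fun w => ?_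
  obtain ⟨c, hc⟩ := hgen w fun x hx => (mem_torsionBySet_iff _ _).1 w.2 ⟨x, hx⟩
  exact ⟨Ideal.Quotient.mk _ c, Subtype.ext hc⟩

theorem isSimpleModule_socle_quotient_maximalIdeal [IsLocalRing R] :
    IsSimpleModule R (socle (maximalIdeal R) (R ⧸ maximalIdeal R)) := by
  have h : socle (maximalIdeal R) (R ⧸ maximalIdeal R) = ⊤ := by
    refine eq_top_iff.2 fun y _ => mem_socle_iff.2 fun x hx => ?_
    obtain ⟨y, rfl⟩ := Submodule.Quotient.mk_surjective _ y
    rw [← Submodule.Quotient.mk_smul, Submodule.Quotient.mk_eq_zero]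
    exact Ideal.mul_mem_right _ _ hx
  have : IsSimpleModule R (R ⧸ maximalIdeal R) :=
    (isSimpleModule_iff_isCoatom).2 (maximalIdeal.isMaximal R).out
  exact IsSimpleModule.congr (LinearEquiv.ofEq _ _ h ≪≫ₗ Submodule.topEquiv)

/-- If the maximal ideal of the Noetherian local ring `R` is generated by a regular sequence `hs`,
then a zero-dimensional quotient of `R` by a regular sequence `gs` of the same length is Gorenstein:
its socle is isomorphic to that of the residue field. -/
theorem isZeroDimGorensteinLocalRing_of_ker_eq_ofList [IsLocalRing R] [IsNoetherianRing R]
    {S : Type*} [CommRing S] [IsLocalRing S] (hdim : ringKrullDim S = 0) {φ : R →+* S}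
    (hφ : Function.Surjective φ) {gs hs : List R} (hker : RingHom.ker φ = Ideal.ofList gs)
    (hgs : IsWeaklyRegular R gs) (hhs : IsWeaklyRegular R hs) (hlen : gs.length = hs.length)
    (hmax : Ideal.ofList hs = maximalIdeal R) : IsZeroDimGorensteinLocalRing S := by
  have hker_le : RingHom.ker φ ≤ maximalIdeal R := le_maximalIdeal (RingHom.ker_ne_top φ)
  obtain ⟨e⟩ := nonempty_socle_equiv_of_isWeaklyRegular hlen
    (fun r hr => hker_le (hker ▸ Ideal.subset_span hr))
    (fun r hr => hmax ▸ Ideal.subset_span hr) hgs hhs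
  have h1 : (Ideal.ofList hs • ⊤ : Submodule R R) = maximalIdeal R := by
    rw [hmax, smul_eq_mul, Ideal.mul_top]
  have h2 : (Ideal.ofList gs • ⊤ : Submodule R R) = RingHom.ker φ := by
    rw [hker, smul_eq_mul, Ideal.mul_top]
  have hsimple : IsSimpleModule R (socle (maximalIdeal R) (R ⧸ RingHom.ker φ)) := by
    have := isSimpleModule_socle_quotient_maximalIdeal (R := R)
    exact IsSimpleModule.congr ((socleCongr _ (quotEquivOfEq _ _ h2.symm)) ≪≫ₗ e ≪≫ₗ
      socleCongr _ (quotEquivOfEq _ _ h1))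
  have hmem : ∀ r : R, (Submodule.Quotient.mk r : R ⧸ RingHom.ker φ) ∈
      socle (maximalIdeal R) _ ↔ ∀ x ∈ maximalIdeal S, x * φ r = 0 := by
    intro r
    rw [mem_socle_iff]
    have : IsLocalHom φ := IsLocalHom.of_surjective φ hφ
    constructor
    · intro h x hx
      obtain ⟨x, rfl⟩ := hφ x
      have hx' : x ∈ maximalIdeal R := (IsLocalRing.mem_maximalIdeal _).2 fun hu =>
        (IsLocalRing.mem_maximalIdeal _).1 hx (hu.map φ)
      have := h x hx'
      rw [← Submodule.Quotient.mk_smul, Submodule.Quotient.mk_eq_zero] at this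
      rw [← map_mul]; exact this
    · intro h x hx
      rw [← Submodule.Quotient.mk_smul, Submodule.Quotient.mk_eq_zero, RingHom.mem_ker, smul_eq_mul,
        map_mul]
      exact h _ (map_nonunit φ x hx)
  have := IsSimpleModule.nontrivial R (socle (maximalIdeal R) (R ⧸ RingHom.ker φ))
  obtain ⟨⟨s, hs⟩, hs0⟩ := exists_ne (0 : socle (maximalIdeal R) (R ⧸ RingHom.ker φ))
  obtain ⟨s, rfl⟩ := Submodule.Quotient.mk_surjective _ s
  -- the socle of `R / ker φ` is simple, hence generated by any non-zero element `s`
  refine isZeroDimGorensteinLocalRing_of_exists hdim (s := φ s) ?_ ((hmem s).1 hs) ?_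
  · intro h
    exact hs0 (Subtype.ext ((Submodule.Quotient.mk_eq_zero _).2 h))
  · intro t ht
    obtain ⟨t, rfl⟩ := hφ t
    obtain ⟨c, hc⟩ := IsSimpleModule.toSpanSingleton_surjective R hs0 ⟨_, (hmem t).2 ht⟩
    refine ⟨φ c, ?_⟩
    have := congrArg Subtype.val hc
    change c • (Submodule.Quotient.mk s : R ⧸ RingHom.ker φ) = Submodule.Quotient.mk t at this
    rw [← Submodule.Quotient.mk_smul, Submodule.Quotient.eq, RingHom.mem_ker, map_sub, sub_eq_zero,
      smul_eq_mul, map_mul] at this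
    exact this

end Socle

/-! ### Maximal ideals of polynomial rings and lengths of regular sequences -/

section MaximalIdeals

open RingTheory.Sequence

theorem RingEquiv.isWeaklyRegular_map {R S : Type*} [CommRing R] [CommRing S] (e : R ≃+* S)
    {l : List R} (h : IsWeaklyRegular R l) : IsWeaklyRegular S (l.map e) :=
  (AddEquiv.isWeaklyRegular_congr (e := e.toAddEquiv) (bs := l.map e) <|
    List.forall₂_map_right_iff.mpr <| List.forall₂_same.mpr fun r _ x => by simp).1 h

/-- If the contraction to `A` of a maximal ideal `M` of `A[X]` is generated by a regular sequence,
so is `M`: modulo the contraction `𝔪`, it becomes a non-zero principal ideal of `(A / 𝔪)[X]`. -/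
theorem Polynomial.exists_isWeaklyRegular_ofList_eq {A : Type*} [CommRing A] [IsJacobsonRing A]
    (M : Ideal (Polynomial A)) [hM : M.IsMaximal] {l : List A} (hl : IsWeaklyRegular A l)
    (hlM : Ideal.ofList l = M.comap Polynomial.C) :
    ∃ q, IsWeaklyRegular (Polynomial A) (l.map Polynomial.C ++ [q]) ∧
      Ideal.ofList (l.map Polynomial.C ++ [q]) = M := by
  have hmax : (M.comap (Polynomial.C : A →+* Polynomial A)).IsMaximal :=
    Polynomial.isMaximal_comap_C_of_isJacobsonRing M
  let k := A ⧸ M.comap (Polynomial.C : A →+* Polynomial A)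
  let _ : Field k := Ideal.Quotient.field _
  let φ : Polynomial A →+* Polynomial k := Polynomial.mapRingHom (Ideal.Quotient.mk _)
  have hφ : Function.Surjective φ := Polynomial.map_surjective _ Ideal.Quotient.mk_surjective
  have hker : RingHom.ker φ = Ideal.ofList (l.map Polynomial.C) := by
    rw [Polynomial.ker_mapRingHom, Ideal.mk_ker, ← hlM, Ideal.map_ofList]
  have hkM : RingHom.ker φ ≤ M := by
    rw [hker, ← Ideal.map_ofList, hlM]
    exact Ideal.map_comap_le
  obtain ⟨p, hp⟩ := (IsPrincipalIdealRing.principal (M.map φ)).principal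
  have hpM : p ∈ M.map φ := hp ▸ Submodule.mem_span_singleton_self p
  obtain ⟨q, hq, rfl⟩ := (Ideal.mem_map_iff_of_surjective φ hφ).1 hpM
  have hMeq : Ideal.ofList (l.map Polynomial.C ++ [q]) = M := by
    rw [Ideal.ofList_append, Ideal.ofList_singleton, ← hker]
    have h1 : (M.map φ).comap φ = M := by
      rw [Ideal.comap_map_of_surjective φ hφ, ← RingHom.ker_eq_comap_bot, sup_eq_left.2 hkM]
    have h2 : (M.map φ).comap φ = RingHom.ker φ ⊔ Ideal.span {q} := by
      rw [hp, Ideal.submodule_span_eq, ← Set.image_singleton, ← Ideal.map_span,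
        Ideal.comap_map_of_surjective φ hφ, ← RingHom.ker_eq_comap_bot, sup_comm]
    rw [← h2, h1]
  refine ⟨q, ?_, hMeq⟩
  rw [isWeaklyRegular_append_iff, isWeaklyRegular_singleton_iff, smul_eq_mul, Ideal.mul_top,
    isSMulRegular_quotient_iff_mem_of_smul_mem, ← hker]
  refine ⟨hl.of_flat, fun a ha => ?_⟩
  rw [RingHom.mem_ker, smul_eq_mul, map_mul] at ha
  refine (mul_eq_zero.1 ha).resolve_left fun h0 => ?_
  have hbot : M.map φ = ⊥ := by rw [hp, h0]; simp
  have : (M.map φ).IsMaximal := by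
    refine (Ideal.map_eq_top_or_isMaximal_of_surjective φ hφ hM).resolve_left fun h => ?_
    rw [hbot] at h
    exact bot_ne_top h
  rw [hbot] at this
  exact Polynomial.not_isField k (Ring.isField_iff_maximal_bot.2 this)

/-- Every maximal ideal of `K[x₁, …, xₙ]` is generated by a regular sequence of length `n`. -/
theorem MvPolynomial.exists_isWeaklyRegular_ofList_eq {K : Type*} [Field K] (n : ℕ)
    (M : Ideal (MvPolynomial (Fin n) K)) [hM : M.IsMaximal] :
    ∃ l : List (MvPolynomial (Fin n) K), l.length = n ∧
      IsWeaklyRegular (MvPolynomial (Fin n) K) l ∧ Ideal.ofList l = M := by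
  induction n with
  | zero =>
    refine ⟨[], rfl, IsWeaklyRegular.nil _ _, ?_⟩
    rw [Ideal.ofList_nil]
    by_contra hne
    obtain ⟨p, hp, hp0⟩ := Submodule.exists_mem_ne_zero_of_ne_bot (Ne.symm hne)
    rw [MvPolynomial.eq_C_of_isEmpty p] at hp hp0
    refine hM.ne_top (Ideal.eq_top_of_isUnit_mem _ hp (IsUnit.map _ ?_))
    exact isUnit_iff_ne_zero.2 fun h => hp0 (by rw [h, MvPolynomial.C_0])
  | succ n ih =>
    let e := (MvPolynomial.finSuccEquiv K n).toRingEquiv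
    let M' : Ideal (Polynomial (MvPolynomial (Fin n) K)) := M.comap e.symm
    have hM' : M'.IsMaximal := Ideal.comap_isMaximal_of_equiv e.symm
    have : (M'.comap (Polynomial.C : MvPolynomial (Fin n) K →+* _)).IsMaximal :=
      Polynomial.isMaximal_comap_C_of_isJacobsonRing M'
    obtain ⟨l, hlen, hl, hlM⟩ := ih (M'.comap Polynomial.C)
    obtain ⟨q, hq, hqM⟩ := Polynomial.exists_isWeaklyRegular_ofList_eq M' hl hlM
    refine ⟨(l.map Polynomial.C ++ [q]).map e.symm, by simp [hlen],
      e.symm.isWeaklyRegular_map hq, ?_⟩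
    have := Ideal.map_ofList e.symm.toRingHom (l.map Polynomial.C ++ [q])
    rw [hqM] at this
    exact this.symm.trans (Ideal.map_comap_of_surjective e.symm.toRingHom e.symm.surjective M)

/-- If `M` is the preimage in `R` of the prime `m` of `R / I`, then `R_M / I R_M` is `(R / I)_m`. -/
theorem isLocalization_atPrime_quotient_map {R : Type*} [CommRing R] (I : Ideal R)
    (m : Ideal (R ⧸ I)) [m.IsPrime] :
    IsLocalization.AtPrime (Localization.AtPrime (m.comap (Ideal.Quotient.mk I)) ⧸
      I.map (algebraMap R (Localization.AtPrime (m.comap (Ideal.Quotient.mk I))))) m := by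
  have h : Algebra.algebraMapSubmonoid (R ⧸ I) (m.comap (Ideal.Quotient.mk I)).primeCompl =
      m.primeCompl :=
    m.map_primeCompl_comap_of_surjective (Ideal.Quotient.mk I) Ideal.Quotient.mk_surjective
  have := (inferInstance : IsLocalization (Algebra.algebraMapSubmonoid (R ⧸ I)
    (m.comap (Ideal.Quotient.mk I)).primeCompl)
    (Localization.AtPrime (m.comap (Ideal.Quotient.mk I)) ⧸
      I.map (algebraMap R (Localization.AtPrime (m.comap (Ideal.Quotient.mk I))))))
  rwa [h] at this

theorem ringKrullDim_eq_zero_of_isLocalization_atPrime {A S : Type*} [CommRing A] [CommRing S]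
    [Algebra A S] [Ring.KrullDimLE 0 A] (m : Ideal A) [m.IsPrime] [IsLocalization.AtPrime S m] :
    ringKrullDim S = 0 := by
  have : Ring.KrullDimLE 0 S :=
    .of_isLocalization m (Ideal.mem_minimalPrimes_of_krullDimLE_zero m) S
  have : Nontrivial S := IsLocalization.AtPrime.nontrivial S m
  exact ringKrullDimZero_iff_ringKrullDim_eq_zero.1 inferInstance

variable {K : Type*} [Field K] {n : ℕ}

theorem exists_isRegular_localization_atPrime (M : Ideal (MvPolynomial (Fin n) K)) [M.IsMaximal] :
    ∃ l : List (Localization.AtPrime M), l.length = n ∧ IsRegular (Localization.AtPrime M) l ∧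
      Ideal.ofList l = IsLocalRing.maximalIdeal (Localization.AtPrime M) := by
  obtain ⟨l, hlen, hl, hlM⟩ := MvPolynomial.exists_isWeaklyRegular_ofList_eq n M
  refine ⟨l.map (algebraMap _ _), by simpa using hlen,
    hl.isRegular_of_isLocalization_of_mem (Localization.AtPrime M) M fun r hr =>
      hlM ▸ Ideal.subset_span hr, ?_⟩
  rw [← Ideal.map_ofList, hlM, Localization.AtPrime.map_eq_maximalIdeal]

theorem ringKrullDim_localization_atPrime (M : Ideal (MvPolynomial (Fin n) K)) [M.IsMaximal] :
    ringKrullDim (Localization.AtPrime M) = n := by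
  obtain ⟨l, hlen, hl, hlM⟩ := exists_isRegular_localization_atPrime M
  have h := ringKrullDim_add_length_eq_ringKrullDim_of_isRegular l hl
  rw [hlM, hlen] at h
  rw [← h, ringKrullDim_eq_zero_of_isField ((Ideal.Quotient.maximal_ideal_iff_isField_quotient _).1
    inferInstance), zero_add]

/-- A regular sequence in `K[x₁, …, xₙ]` generating a proper ideal with zero-dimensional quotient
has length `n`. -/
theorem length_eq_of_isWeaklyRegular {l : List (MvPolynomial (Fin n) K)}
    (hl : IsWeaklyRegular (MvPolynomial (Fin n) K) l) (htop : Ideal.ofList l ≠ ⊤)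
    [Ring.KrullDimLE 0 (MvPolynomial (Fin n) K ⧸ Ideal.ofList l)] : l.length = n := by
  have : Nontrivial (MvPolynomial (Fin n) K ⧸ Ideal.ofList l) := Ideal.Quotient.nontrivial_iff.2 htop
  obtain ⟨m, hm⟩ := Ideal.exists_maximal (MvPolynomial (Fin n) K ⧸ Ideal.ofList l)
  have hmM : (m.comap (Ideal.Quotient.mk (Ideal.ofList l))).IsMaximal :=
    Ideal.comap_isMaximal_of_surjective _ Ideal.Quotient.mk_surjective
  have hreg := hl.isRegular_of_isLocalization_of_mem
    (Localization.AtPrime (m.comap (Ideal.Quotient.mk (Ideal.ofList l))))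
    (m.comap (Ideal.Quotient.mk (Ideal.ofList l))) fun r hr => by
      rw [Ideal.mem_comap, Ideal.Quotient.eq_zero_iff_mem.2
        (Ideal.subset_span hr : r ∈ Ideal.ofList l)]
      exact zero_mem _
  have h := ringKrullDim_add_length_eq_ringKrullDim_of_isRegular _ hreg
  have := isLocalization_atPrime_quotient_map _ m
  rw [ringKrullDim_localization_atPrime, ← Ideal.map_ofList, List.length_map,
    ringKrullDim_eq_zero_of_isLocalization_atPrime m, zero_add] at h
  exact_mod_cast h

end MaximalIdeals

/-! ### Complete intersections and Gorenstein schemes -/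

section CompleteIntersections

open RingTheory.Sequence MvPolynomial

theorem Ideal.ofList_ofFn {R : Type*} [CommRing R] {r : ℕ} (f : Fin r → R) :
    Ideal.ofList (List.ofFn f) = Ideal.span (Set.range f) :=
  congrArg Ideal.span (Set.ext fun x => by simp [List.mem_ofFn])

variable {K : Type*} [Field K] {n : ℕ} {I : Ideal (MvPolynomial (Fin n) K)}

theorem isRegular_ofFn_and_span_eq (hI : I ≠ ⊤) {r : ℕ} {f : Fin r → MvPolynomial (Fin n) K}
    (hfI : ∀ i, f i ∈ I)
    (hreg : IsWeaklyRegular (MvPolynomial (Fin n) K) (List.ofFn fun i => degreeForm (f i)))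
    (hDF : degreeFormIdeal I = Ideal.span (Set.range fun i => degreeForm (f i))) :
    IsRegular (MvPolynomial (Fin n) K) (List.ofFn f) ∧ Ideal.span (Set.range f) = I := by
  have hmap : (List.ofFn fun i => degreeForm (f i)) = (List.ofFn f).map degreeForm := by
    rw [List.map_ofFn]; rfl
  rw [← Ideal.ofList_ofFn, hmap] at hDF
  rw [hmap] at hreg
  obtain ⟨h1, h2⟩ := isWeaklyRegular_and_degreeFormIdeal_ofList _ hreg
  have hle : Ideal.span (Set.range f) ≤ I := Ideal.span_le.2 (Set.range_subset_iff.2 hfI)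
  have heq : Ideal.span (Set.range f) = I := by
    refine le_antisymm hle (le_of_degreeFormIdeal_le hle ?_)
    rw [hDF, ← h2, Ideal.ofList_ofFn]
  refine ⟨⟨h1, ?_⟩, heq⟩
  rw [Ideal.ofList_ofFn, heq, smul_eq_mul, Ideal.mul_top]
  exact hI.symm

theorem isLocallyCompleteIntersection_of_span_eq {f : Fin n → MvPolynomial (Fin n) K}
    (hf : IsWeaklyRegular (MvPolynomial (Fin n) K) (List.ofFn f))
    (hfI : Ideal.span (Set.range f) = I) : IsLocallyCompleteIntersection I := by
  intro m hm
  refine ⟨fun i => algebraMap _ _ (f i), ?_, ?_⟩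
  · have := hf.isRegular_of_isLocalization_of_mem
      (Localization.AtPrime (m.comap (Ideal.Quotient.mk I))) (m.comap (Ideal.Quotient.mk I))
      fun r hr => by
        rw [Ideal.mem_comap, Ideal.Quotient.eq_zero_iff_mem.2]
        · exact zero_mem _
        · rw [← hfI, ← Ideal.ofList_ofFn]
          exact Ideal.subset_span hr
    rwa [List.map_ofFn] at this
  · conv_lhs => arg 2; rw [← hfI]
    rw [Ideal.map_span, ← Set.range_comp]
    rfl

/-- The local ring at a complete intersection point is Gorenstein. It is allowed to be any
localization `S`, so that the result also applies to a local ring as its own localization. -/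
theorem IsCompleteIntersectionAt.isZeroDimGorensteinLocalRing
    {m : Ideal (MvPolynomial (Fin n) K ⧸ I)} [hm : m.IsMaximal] (h : IsCompleteIntersectionAt I m)
    [Ring.KrullDimLE 0 (MvPolynomial (Fin n) K ⧸ I)] {S : Type*} [CommRing S]
    [Algebra (MvPolynomial (Fin n) K ⧸ I) S] [IsLocalization.AtPrime S m] :
    IsZeroDimGorensteinLocalRing S := by
  obtain ⟨g, hg, hgI⟩ := h
  have hM : (m.comap (Ideal.Quotient.mk I)).IsMaximal :=
    Ideal.comap_isMaximal_of_surjective _ Ideal.Quotient.mk_surjective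
  obtain ⟨l, hlen, hl, hlM⟩ := exists_isRegular_localization_atPrime (m.comap (Ideal.Quotient.mk I))
  have := isLocalization_atPrime_quotient_map I m
  let e := IsLocalization.algEquiv m.primeCompl
    (Localization.AtPrime (m.comap (Ideal.Quotient.mk I)) ⧸
      I.map (algebraMap _ (Localization.AtPrime (m.comap (Ideal.Quotient.mk I))))) S
  have : IsLocalRing S := IsLocalization.AtPrime.isLocalRing S m
  have : IsNoetherianRing (Localization.AtPrime (m.comap (Ideal.Quotient.mk I))) :=
    IsLocalization.isNoetherianRing (m.comap (Ideal.Quotient.mk I)).primeCompl _ inferInstance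
  let φ := e.toRingEquiv.toRingHom.comp (Ideal.Quotient.mk
    (I.map (algebraMap _ (Localization.AtPrime (m.comap (Ideal.Quotient.mk I))))))
  refine isZeroDimGorensteinLocalRing_of_ker_eq_ofList
    (ringKrullDim_eq_zero_of_isLocalization_atPrime m) (φ := φ) (gs := List.ofFn g)
    (e.surjective.comp Ideal.Quotient.mk_surjective) ?_ hg.toIsWeaklyRegular hl.toIsWeaklyRegular
    (by rw [List.length_ofFn, hlen]) hlM
  rw [Ideal.ofList_ofFn, ← hgI]
  ext x
  rw [RingHom.mem_ker, RingHom.comp_apply, ← Ideal.Quotient.eq_zero_iff_mem]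
  exact EmbeddingLike.map_eq_zero_iff (f := e)

/-- A homogeneous regular sequence generating `DF(I)` has length `n` and consists of degree forms
of elements of `I`. -/
theorem IsStrictCompleteIntersection.exists_degreeForm (h : IsStrictCompleteIntersection I)
    [Ring.KrullDimLE 0 (MvPolynomial (Fin n) K ⧸ I)] :
    ∃ f : Fin n → MvPolynomial (Fin n) K, (∀ i, f i ∈ I ∧ f i ≠ 0) ∧
      degreeFormIdeal I = Ideal.span (Set.range fun i => degreeForm (f i)) ∧
      IsWeaklyRegular (MvPolynomial (Fin n) K) (List.ofFn fun i => degreeForm (f i)) := by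
  obtain ⟨r, g, hg, hreg, hspan⟩ := h
  rw [← Ideal.ofList_ofFn] at hspan
  have htop : Ideal.ofList (List.ofFn g) ≠ ⊤ := by
    have := hreg.top_ne_smul
    rw [smul_eq_mul, Ideal.mul_top] at this
    exact this.symm
  have : Ring.KrullDimLE 0 (MvPolynomial (Fin n) K ⧸ Ideal.ofList (List.ofFn g)) := by
    rw [← hspan]; exact krullDimLE_zero_quotient_degreeFormIdeal
  have hr : r = n := by
    simpa using length_eq_of_isWeaklyRegular hreg.toIsWeaklyRegular htop
  subst hr
  -- `0` is regular only on the zero module, but `P / (g₁, …, gᵢ₋₁)` is non-zero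
  have hg0 : ∀ i, g i ≠ 0 := by
    intro i hi
    have h1 := hreg.regular_mod_prev i (by simp)
    rw [List.getElem_ofFn, Fin.eta, hi] at h1
    have hle : Ideal.ofList ((List.ofFn g).take i) ≤ Ideal.ofList (List.ofFn g) :=
      Ideal.span_mono fun x hx => List.mem_of_mem_take hx
    rw [smul_eq_mul, Ideal.mul_top, isSMulRegular_quotient_iff_mem_of_smul_mem] at h1
    exact htop (top_le_iff.1 (le_trans (fun x _ => h1 x (by simp)) hle))
  have hex : ∀ i, ∃ f ∈ I, f ≠ 0 ∧ degreeForm f = g i := fun i =>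
    (hg i).elim fun d hd => exists_degreeForm_eq hd (hg0 i)
      (hspan ▸ Ideal.subset_span (List.mem_ofFn.2 ⟨i, rfl⟩))
  choose f hfI hf0 hfg using hex
  refine ⟨f, fun i => ⟨hfI i, hf0 i⟩, ?_, ?_⟩
  · simp only [hfg]; rw [hspan, Ideal.ofList_ofFn]
  · simpa only [hfg] using hreg.toIsWeaklyRegular

theorem IsStrictCompleteIntersection.isLocallyCompleteIntersection (hI : I ≠ ⊤)
    (h : IsStrictCompleteIntersection I) [Ring.KrullDimLE 0 (MvPolynomial (Fin n) K ⧸ I)] :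
    IsLocallyCompleteIntersection I := by
  obtain ⟨f, hf, hDF, hreg⟩ := h.exists_degreeForm
  obtain ⟨h1, h2⟩ := isRegular_ofFn_and_span_eq hI (fun i => (hf i).1) hreg hDF
  exact isLocallyCompleteIntersection_of_span_eq h1.toIsWeaklyRegular h2

/-- `DF(I)` is generated by a regular sequence, hence defines a locally complete intersection, and
`P / DF(I)` is local, hence is its own localization; so it is Gorenstein. -/
theorem IsStrictCompleteIntersection.isStrictGorenstein (hI : I ≠ ⊤)
    (h : IsStrictCompleteIntersection I) [Ring.KrullDimLE 0 (MvPolynomial (Fin n) K ⧸ I)] :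
    IsStrictGorenstein I := by
  obtain ⟨f, hf, hDF, hreg⟩ := h.exists_degreeForm
  have hCI : IsLocallyCompleteIntersection (degreeFormIdeal I) :=
    isLocallyCompleteIntersection_of_span_eq hreg hDF.symm
  have : IsLocalRing (MvPolynomial (Fin n) K ⧸ degreeFormIdeal I) :=
    isLocalRing_quotient_degreeFormIdeal hI
  have : Ring.KrullDimLE 0 (MvPolynomial (Fin n) K ⧸ degreeFormIdeal I) :=
    krullDimLE_zero_quotient_degreeFormIdeal
  -- a local ring is its own localization at the maximal ideal
  have : IsLocalization.AtPrime (MvPolynomial (Fin n) K ⧸ degreeFormIdeal I)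
      (IsLocalRing.maximalIdeal (MvPolynomial (Fin n) K ⧸ degreeFormIdeal I)) :=
    IsLocalization.of_le_isUnit fun x hx => by
      simpa [IsUnit.mem_submonoid_iff] using hx
  exact (hCI (IsLocalRing.maximalIdeal _)).isZeroDimGorensteinLocalRing

end CompleteIntersections

/-- Basic properties of a `0`-dimensional subscheme of affine `n`-space over a field `K`, given by
its vanishing ideal `I`. -/
theorem proposition4p3 {K : Type*} [Field K] (n : ℕ) (I : Ideal (MvPolynomial (Fin n) K))
    (hI : ringKrullDim (MvPolynomial (Fin n) K ⧸ I) = 0) :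
    (IsStrictCompleteIntersection I →
      ∃ f : Fin n → MvPolynomial (Fin n) K, (∀ i, f i ∈ I ∧ f i ≠ 0) ∧
        degreeFormIdeal I = Ideal.span (Set.range fun i => degreeForm (f i))) ∧
    (∀ f : Fin n → MvPolynomial (Fin n) K, (∀ i, f i ∈ I) → IsStrictRegularSequence f →
      degreeFormIdeal I = Ideal.span (Set.range fun i => degreeForm (f i)) →
      RingTheory.Sequence.IsRegular (MvPolynomial (Fin n) K) (List.ofFn f) ∧
        Ideal.span (Set.range f) = I) ∧
    (IsStrictCompleteIntersection I → IsLocallyCompleteIntersection I) ∧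
    (IsStrictCompleteIntersection I → IsStrictGorenstein I) ∧
    (IsLocallyCompleteIntersection I → IsLocallyGorenstein I) := by
  have : Nontrivial (MvPolynomial (Fin n) K ⧸ I) := by
    by_contra hne
    rw [not_nontrivial_iff_subsingleton] at hne
    simp [ringKrullDim_eq_bot_of_subsingleton] at hI
  have htop : I ≠ ⊤ := Ideal.Quotient.nontrivial_iff.1 this
  have : Ring.KrullDimLE 0 (MvPolynomial (Fin n) K ⧸ I) :=
    ringKrullDimZero_iff_ringKrullDim_eq_zero.2 hI
  refine ⟨fun h => ?_, fun f hf hreg hDF => ?_, fun h => h.isLocallyCompleteIntersection htop,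
    fun h => h.isStrictGorenstein htop, fun h m _ => (h m).isZeroDimGorensteinLocalRing⟩
  · obtain ⟨f, hf, hDF, -⟩ := h.exists_degreeForm
    exact ⟨f, hf, hDF⟩
  · exact isRegular_ofFn_and_span_eq htop hf hreg.2.toIsWeaklyRegular hDF
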